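/- Let $\Omega\subset\mathbb{R}^2$ be a bounded, open, convex set containing the origin, and let $\rho(\xi)=\inf\{t>0:\ t^{-1}\xi\in\Omega\}$ be its Minkowski functional. For $\lambda>0$ let $T_\lambda$ be the operator given by $\mathcal{F}[T_\lambda f](\xi)=(1-\rho(\xi))_+^{\lambda}\,\widehat f(\xi)$, and let $\mathcal{F}[T_0f]=\chi_\Omega\widehat f$; say that $T_\lambda$ is bounded on $L^p(\mathbb{R}^2)$ if there is a finite $C$ with $\|T_\lambda f\|_p\le C\|f\|_p$ for all Schwartz functions $f$. A supporting line for $\Omega$ at $q\in\partial\Omega$ is a line $\ell\ni q$ such that $\Omega$ lies in the half plane containing the origin with boundary $\ell$. For $\delta>0$ let $\mathcal{B}_\delta$ be the family of all caps $\{x\in\partial\Omega:\ \operatorname{dist}(x,\ell)<\delta\}$, where $\ell$ is a supporting line for $\Omega$ at some $q\in\partial\Omega$; let $N(\Omega,\delta)$ be the minimum number of members of $\mathcal{B}_\delta$ needed to cover $\partial\Omega$, and let $$\kappa_\Omega=\limsup_{\delta\to0^+}\frac{\log N(\Omega,\delta)}{\log\delta^{-1}}.$$ Then: (1) If $1\le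 p\le2$, $\lambda\ge0$ and $\lambda<\frac{\kappa_\Omega}{2}+\frac1p-1$, then $T_\lambda$ is unbounded on $L^p(\mathbb{R}^2)$. (2) In particular, with $p_{\mathrm{crit}}:=\inf\{p\ge1:\ T_\lambda\text{ is bounded on }L^p(\mathbb{R}^2)\text{ for all }\lambda>0\}$, we have $p_{\mathrm{crit}}\ge\frac{2}{2-\kappa_\Omega}$. -/

import Mathlib

open MeasureTheory Filter Topology
open scoped NNReal ENNReal FourierTransform SchwartzMap RealInnerProductSpace

noncomputable section

namespace BochnerRiesz

/-- The Euclidean plane. -/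
abbrev Plane : Type := EuclideanSpace ℝ (Fin 2)

/-- `ℓ` is a supporting line for `Ω` at `p`: the line through `p` with unit normal `n`, such that
`Ω` lies in the half plane `⟪n, x⟫ ≤ ⟪n, p⟫` bounded by `ℓ` (if `0 ∈ Ω`, this is the half plane
that contains the origin). -/
def IsSupportingLine (Ω : Set Plane) (p : Plane) (ℓ : Set Plane) : Prop :=
  ∃ n : Plane, ‖n‖ = 1 ∧ ℓ = {x | ⟪n, x⟫ = ⟪n, p⟫} ∧ ∀ x ∈ Ω, ⟪n, x⟫ ≤ ⟪n, p⟫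

/-- The cap `B(p, ℓ, δ)` cut from the boundary of `Ω` by the open `δ`-neighbourhood of `ℓ`; it
depends on `p` only through `ℓ`. -/
def cap (Ω : Set Plane) (ℓ : Set Plane) (δ : ℝ) : Set Plane :=
  {x ∈ frontier Ω | Metric.infDist x ℓ < δ}

/-- The family of all caps `B(p, ℓ, δ)`, with `p` in the boundary of `Ω` and `ℓ` a supporting line
for `Ω` at `p`. -/
def caps (Ω : Set Plane) (δ : ℝ) : Set (Set Plane) :=
  {B | ∃ p ∈ frontier Ω, ∃ ℓ : Set Plane, IsSupportingLine Ω p ℓ ∧ B = cap Ω ℓ δ}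

/-- `N(Ω, δ)`: the minimum number of caps of width `δ` needed to cover the boundary of `Ω`. -/
def coverNum (Ω : Set Plane) (δ : ℝ) : ℕ :=
  sInf {k : ℕ | ∃ S : Finset (Set Plane),
    (S : Set (Set Plane)) ⊆ caps Ω δ ∧ frontier Ω ⊆ ⋃₀ (S : Set (Set Plane)) ∧ S.card = k}

/-- `κ_Ω = limsup_{δ → 0+} log N(Ω, δ) / log (1 / δ)`. -/
def kappa (Ω : Set Plane) : ℝ :=
  limsup (fun δ : ℝ => Real.log (coverNum Ω δ) / Real.log δ⁻¹) (𝓝[>] 0)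

/-- The multiplier `(1 - ρ)_+ ^ lam` for `lam ≠ 0`, where `ρ` is the Minkowski functional of `Ω`,
and the characteristic function of `Ω` for `lam = 0`. -/
def multiplier (Ω : Set Plane) (lam : ℝ) (ξ : Plane) : ℝ :=
  if lam = 0 then Ω.indicator (fun _ => 1) ξ else (max (1 - gauge Ω ξ) 0) ^ lam

/-- The generalized Bochner-Riesz operator `T_lam` of `Ω`, given by
`𝓕 (T_lam f) = multiplier Ω lam * 𝓕 f`. -/
def T (Ω : Set Plane) (lam : ℝ) (f : Plane → ℂ) : Plane → ℂ :=
  𝓕⁻ (fun ξ => (multiplier Ω lam ξ : ℂ) * 𝓕 f ξ)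

/-- `T_lam` is bounded on `L^p(ℝ²)`: the estimate `‖T_lam f‖_p ≤ C ‖f‖_p` holds with a finite
constant `C` on the (for `p < ∞` dense) class of Schwartz functions, on which the integrals
that define `T_lam` converge absolutely when `0 ≤ lam`. -/
def BoundedOnLp (Ω : Set Plane) (lam : ℝ) (p : ℝ≥0∞) : Prop :=
  ∃ C : ℝ≥0, ∀ f : 𝓢(Plane, ℂ),
    eLpNorm (T Ω lam f) p volume ≤ C * eLpNorm f p volume

/-- `p_crit = inf {p ≥ 1 : T_lam is bounded on L^p for all lam > 0}`. -/
def pCrit (Ω : Set Plane) : ℝ :=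
  sInf {p : ℝ | 1 ≤ p ∧ ∀ lam : ℝ, 0 < lam → BoundedOnLp Ω lam (ENNReal.ofReal p)}

end BochnerRiesz

end

/-!
If `T_lam` is bounded on `L^p`, then its convolution kernel `K = 𝓕⁻ (multiplier Ω lam)` belongs to
`L^p`, as one sees by applying `T_lam` to a Schwartz function whose Fourier transform is `1` on `Ω`.
The proof shows that `K ∈ L^p` forces `N(Ω, δ) ≤ C δ ^ (-(lam + 2 - 2 / p))` for small `δ`
(`exists_coverNum_le`), hence `kappa Ω ≤ lam + 2 - 2 / p`. Since `0 ≤ lam`, this is stronger than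
the asserted `lam ≥ 1 / p - 1 + kappa Ω / 2`. Letting `lam → 0` it also bounds `pCrit` from below;
here the set whose infimum is `pCrit` is nonempty because `p = 2` belongs to it by Plancherel's
theorem.

*The kernel along rays.* Let `h` be the support function of `Ω` and `e` a unit vector. Since
`∫₀^∞ R exp (-a R) dR = a⁻²`, integrating `K (R e)` against `i δ² R exp (-δ R)` times a suitable
phase gives the integral of the multiplier against `i / (1 + i v)²`, where
`v = 2π (h(e) - ⟪e, ξ⟫) / δ + 1 ≥ 1` on `Ω`. The real part of this weight is `2v / (1 + v²)²`, which is
positive, and bounded below where `ξ` lies within `O(δ)` of the supporting line with normal `e`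
(`ofReal_integral_le_lintegral_ray`). So the integral of `δ² R exp (-δ R) |K (R e)|` over `R > 0`
is at least a constant times the mass of the multiplier on that cap, which is at least about
`δ ^ lam` times the area of the cap (`le_lintegral_ray`). As `R dR de` is the area element, the
integral over all `e` equals `δ² ∫ |K| exp (-δ |x|)`, which is `O(δ ^ (2 / p))` by Hölder's
inequality (`lintegral_rays_le`).

*Counting caps.* Let `W` be the area of the cap of width `δ` with normal `e`. Its length is
`O(W / δ)`, since by convexity the cap contains a triangle of comparable length and width. Therefore
turning `e` by at most a small multiple of `δ² / W` keeps the points of support inside the cap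
(`IsBodyBetween.mem_capRegion_of_support`) and yields caps of comparable width that contain it
(`IsBodyBetween.capRegion_subset`). Vitali's covering lemma supplies disjoint arcs of such radii
whose enlargements cover the circle; the corresponding caps then cover the boundary, and each arc
contributes about `(δ² / W) (δ ^ lam W) = δ ^ (lam + 2)` to the integral over `e`. Comparison with
the upper bound `O(δ ^ (2 / p))` limits the number of arcs.
-/

open MeasureTheory Filter Topology
open scoped NNReal ENNReal FourierTransform SchwartzMap RealInnerProductSpace

noncomputable section

namespace BochnerRiesz

/-! ### Directions in the plane -/

/-- The unit vector of the plane in the direction of the angle `t`. -/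
def dir (t : ℝ) : Plane := !₂[Real.cos t, Real.sin t]

lemma inner_plane (x y : Plane) : ⟪x, y⟫ = x 0 * y 0 + x 1 * y 1 := by
  simp [PiLp.inner_apply, Fin.sum_univ_two]; ring

lemma inner_dir (t : ℝ) (x : Plane) : ⟪dir t, x⟫ = Real.cos t * x 0 + Real.sin t * x 1 := by
  simp [inner_plane, dir]

lemma norm_dir (t : ℝ) : ‖dir t‖ = 1 := by
  simp [EuclideanSpace.norm_eq, dir, Fin.sum_univ_two]

lemma inner_dir_add (t τ : ℝ) (x : Plane) :
    ⟪dir (t + τ), x⟫ = Real.cos τ * ⟪dir t, x⟫ + Real.sin τ * ⟪dir (t + Real.pi / 2), x⟫ := by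
  simp only [inner_dir, Real.cos_add, Real.sin_add, Real.cos_pi_div_two, Real.sin_pi_div_two]
  ring

lemma abs_inner_dir_le (t : ℝ) (x : Plane) : |⟪dir t, x⟫| ≤ ‖x‖ := by
  simpa [norm_dir] using abs_real_inner_le_norm (dir t) x

lemma exists_eq_dir (n : Plane) (hn : ‖n‖ = 1) : ∃ t ∈ Set.Icc (-Real.pi) Real.pi, n = dir t := by
  set z : ℂ := ⟨n 0, n 1⟩ with hz
  have h1 : ‖z‖ = 1 := by
    rw [← hn, EuclideanSpace.norm_eq, Fin.sum_univ_two, Complex.norm_def, Complex.normSq_apply]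
    simp [hz, sq]
  refine ⟨z.arg, ⟨(Complex.neg_pi_lt_arg z).le, Complex.arg_le_pi z⟩, ?_⟩
  have hc := Complex.norm_mul_cos_arg z
  have hs := Complex.norm_mul_sin_arg z
  rw [h1, one_mul] at hc hs
  ext i
  fin_cases i
  · exact hc.symm
  · exact hs.symm

/-- A planar set containing the parallelogram at `a` spanned by `u / 2` and `v / 2` has at least
the area of that parallelogram. -/
lemma le_volume_of_parallelogram_subset {S : Set Plane} (a u v : Plane)
    (h : ∀ α ∈ Set.Icc (0 : ℝ) (1 / 2), ∀ β ∈ Set.Icc (0 : ℝ) (1 / 2), a + α • u + β • v ∈ S) :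
    ENNReal.ofReal (|u 0 * v 1 - u 1 * v 0| / 4) ≤ volume S := by
  set A : Matrix (Fin 2) (Fin 2) ℝ := !![u 0, v 0; u 1, v 1] with hA
  set L : Plane →ₗ[ℝ] Plane := Matrix.toEuclideanLin A with hL
  have hdet : LinearMap.det L = u 0 * v 1 - u 1 * v 0 := by
    rw [hL, Matrix.toEuclideanLin_eq_toLin_orthonormal, LinearMap.det_toLin, hA, Matrix.det_fin_two]
    simp; ring
  set Q : Set Plane := (WithLp.ofLp) ⁻¹' (Set.Icc (0 : Fin 2 → ℝ) (fun _ => 1 / 2)) with hQ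
  have hvQ : volume Q = ENNReal.ofReal (1 / 4) := by
    rw [hQ, (PiLp.volume_preserving_ofLp (Fin 2)).measure_preimage
      measurableSet_Icc.nullMeasurableSet, Real.volume_Icc_pi]
    simp only [Pi.zero_apply, sub_zero, Fin.prod_univ_two]
    rw [← ENNReal.ofReal_mul (by norm_num)]
    norm_num
  have hsub : (fun x => a + x) '' (L '' Q) ⊆ S := by
    rintro _ ⟨_, ⟨x, hx, rfl⟩, rfl⟩
    have h0 := hx.1; have h1 := hx.2
    have := h (x 0) ⟨h0 0, h1 0⟩ (x 1) ⟨h0 1, h1 1⟩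
    convert this using 1
    ext i
    fin_cases i <;> simp [hL, hA, Matrix.toLpLin_apply, dotProduct, Fin.sum_univ_two] <;> ring
  calc ENNReal.ofReal (|u 0 * v 1 - u 1 * v 0| / 4)
      = volume ((fun x => a + x) '' (L '' Q)) := by
        rw [Set.image_add_left, measure_preimage_add, Measure.addHaar_image_linearMap, hdet, hvQ,
          ← ENNReal.ofReal_mul (abs_nonneg _)]
        congr 1; ring
    _ ≤ volume S := measure_mono hsub


/-- A convex set that contains `x` and the disc of radius `ρ` about `w` contains the parallelogram
at `w` spanned by the halves of `x - w` and of the radius in the direction `dir t`. -/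
lemma mul_abs_inner_le_volume {S : Set Plane} (hS : Convex ℝ S) {w x : Plane} {ρ : ℝ}
    (hρ : 0 ≤ ρ) (hw : ∀ v : Plane, ‖v‖ ≤ ρ → w + v ∈ S) (hx : x ∈ S) (hfin : volume S ≠ ∞)
    (t : ℝ) : ρ * |⟪dir (t + Real.pi / 2), x - w⟫| ≤ 4 * volume.real S := by
  have key := le_volume_of_parallelogram_subset (S := S) w (x - w) (ρ • dir t) ?_
  · have h2 := (ENNReal.ofReal_le_iff_le_toReal hfin).1 key
    have h3 : (x - w) 0 * (ρ • dir t) 1 - (x - w) 1 * (ρ • dir t) 0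
        = -(ρ * ⟪dir (t + Real.pi / 2), x - w⟫) := by
      rw [inner_dir, Real.cos_add_pi_div_two, Real.sin_add_pi_div_two]
      simp only [dir, PiLp.smul_apply, smul_eq_mul, Matrix.cons_val_zero,
        Matrix.cons_val_one, PiLp.sub_apply]
      ring
    rw [h3, abs_neg, abs_mul, abs_of_nonneg hρ] at h2
    simp only [Measure.real]
    linarith
  · rintro α ⟨hα0, hα1⟩ β ⟨hβ0, hβ1⟩
    have h1 : (0 : ℝ) < 1 - α := by linarith
    have hmem : w + (β / (1 - α) * ρ) • dir t ∈ S := by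
      apply hw
      rw [norm_smul, norm_dir, mul_one, Real.norm_of_nonneg (by positivity)]
      have : β / (1 - α) ≤ 1 := by rw [div_le_one h1]; linarith
      nlinarith
    have := hS hx hmem hα0 h1.le (by ring)
    convert this using 1
    have e : (1 - α) * (β / (1 - α) * ρ) = β * ρ := by field_simp
    rw [smul_add (1 - α), smul_smul (1 - α), e]
    module

/-! ### Caps of a planar convex body -/

/-- The support function `t ↦ sup {⟪dir t, x⟫ : x ∈ A}` of a planar set. -/
def supportFn (A : Set Plane) (t : ℝ) : ℝ := sSup ((fun x => ⟪dir t, x⟫) '' A)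

/-- The part of `A` within distance `δ` of the supporting line of `A` with outer normal `dir t`. -/
def capRegion (A : Set Plane) (t δ : ℝ) : Set Plane := {x ∈ A | supportFn A t - δ ≤ ⟪dir t, x⟫}

lemma continuous_inner_dir (t : ℝ) : Continuous fun x : Plane => ⟪dir t, x⟫ := by fun_prop

lemma inner_le_supportFn {A : Set Plane} (hA : IsCompact A) (t : ℝ) {x : Plane} (hx : x ∈ A) :
    ⟪dir t, x⟫ ≤ supportFn A t :=
  le_csSup (hA.image (continuous_inner_dir t)).bddAbove ⟨x, hx, rfl⟩

lemma exists_inner_eq_supportFn {A : Set Plane} (hA : IsCompact A) (hne : A.Nonempty) (t : ℝ) :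
    ∃ q ∈ A, ⟪dir t, q⟫ = supportFn A t :=
  (hA.image (continuous_inner_dir t)).sSup_mem (hne.image _)

lemma convex_capRegion {A : Set Plane} (hA : Convex ℝ A) (t δ : ℝ) :
    Convex ℝ (capRegion A t δ) := by
  intro x hx y hy a b ha hb hab
  refine ⟨hA hx.1 hy.1 ha hb hab, ?_⟩
  rw [inner_add_right, inner_smul_right, inner_smul_right]
  have h1 := mul_le_mul_of_nonneg_left hx.2 ha
  have h2 := mul_le_mul_of_nonneg_left hy.2 hb
  have : supportFn A t - δ = a * (supportFn A t - δ) + b * (supportFn A t - δ) := by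
    rw [← add_mul, hab, one_mul]
  linarith

lemma isCompact_capRegion {A : Set Plane} (hA : IsCompact A) (t δ : ℝ) :
    IsCompact (capRegion A t δ) :=
  hA.inter_right (isClosed_le continuous_const (continuous_inner_dir t))

/-- A compact convex planar set lying between the discs of radii `r > 0` and `M` about `0`. -/
structure IsBodyBetween (A : Set Plane) (r M : ℝ) : Prop where
  isCompact : IsCompact A
  convex : Convex ℝ A
  pos : 0 < r
  closedBall_subset : Metric.closedBall 0 r ⊆ A
  subset_closedBall : A ⊆ Metric.closedBall 0 M

namespace IsBodyBetween

variable {A : Set Plane} {r M : ℝ}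

lemma nonempty (hA : IsBodyBetween A r M) : A.Nonempty :=
  ⟨0, hA.closedBall_subset (by simp [hA.pos.le])⟩

lemma le (hA : IsBodyBetween A r M) : r ≤ M := by
  have : r • dir 0 ∈ Metric.closedBall (0 : Plane) M :=
    hA.subset_closedBall (hA.closedBall_subset (by simp [norm_smul, norm_dir, abs_of_pos hA.pos]))
  simpa [norm_smul, norm_dir, abs_of_pos hA.pos] using this

lemma norm_le (hA : IsBodyBetween A r M) {x : Plane} (hx : x ∈ A) : ‖x‖ ≤ M := by
  simpa using hA.subset_closedBall hx

lemma abs_inner_le (hA : IsBodyBetween A r M) {x : Plane} (hx : x ∈ A) (t : ℝ) :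
    |⟪dir t, x⟫| ≤ M := (abs_inner_dir_le t x).trans (hA.norm_le hx)

/-- The disc comes from shrinking the disc of radius `r` about `0` towards a point of support. -/
lemma exists_disc_subset_capRegion (hA : IsBodyBetween A r M) (t : ℝ) {δ : ℝ} (hδ : 0 < δ)
    (hδM : δ ≤ M) : ∃ w : Plane, ∀ v : Plane, ‖v‖ ≤ δ * r / (4 * M) → w + v ∈ capRegion A t δ := by
  have hr := hA.pos
  have hM : 0 < M := hr.trans_le hA.le
  obtain ⟨q, hq, hqs⟩ := exists_inner_eq_supportFn hA.isCompact hA.nonempty t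
  set σ := δ / (4 * M) with hσ
  have hσ0 : 0 < σ := by positivity
  have hσM : σ * M = δ / 4 := by rw [hσ]; field_simp
  have hσ1 : σ ≤ 1 := by rw [hσ, div_le_one (by positivity)]; linarith
  refine ⟨(1 - σ) • q, fun v hv => ?_⟩
  have hy : σ⁻¹ • v ∈ A := by
    apply hA.closedBall_subset
    rw [mem_closedBall_zero_iff, norm_smul, norm_inv, Real.norm_of_nonneg hσ0.le,
      inv_mul_le_iff₀ hσ0]
    calc ‖v‖ ≤ _ := hv
      _ = σ * r := by rw [hσ]; ring
  have hv' : v = σ • (σ⁻¹ • v) := by rw [smul_smul, mul_inv_cancel₀ hσ0.ne', one_smul]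
  rw [hv']
  refine ⟨hA.convex hq hy (by linarith) hσ0.le (by ring), ?_⟩
  rw [inner_add_right, inner_smul_right, inner_smul_right, hqs]
  have h1 := (abs_le.1 (hA.abs_inner_le hy t)).1
  have h2 := (abs_le.1 (hA.abs_inner_le hq t)).2
  rw [hqs] at h2
  nlinarith

lemma volume_capRegion_ne_top (hA : IsBodyBetween A r M) (t δ : ℝ) :
    volume (capRegion A t δ) ≠ ∞ := (isCompact_capRegion hA.isCompact t δ).measure_lt_top.ne

/-- The length of a cap times its width is at most a multiple of its area. -/
lemma abs_inner_sub_le_area (hA : IsBodyBetween A r M) (t : ℝ) {δ : ℝ} (hδ : 0 < δ)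
    (hδM : δ ≤ M) {x y : Plane} (hx : x ∈ capRegion A t δ) (hy : y ∈ capRegion A t δ) :
    δ * r * |⟪dir (t + Real.pi / 2), x - y⟫| ≤ 32 * M * volume.real (capRegion A t δ) := by
  have hr := hA.pos
  have hM : 0 < M := hr.trans_le hA.le
  obtain ⟨w, hw⟩ := hA.exists_disc_subset_capRegion t hδ hδM
  have key : ∀ x ∈ capRegion A t δ, δ * r * |⟪dir (t + Real.pi / 2), x - w⟫|
      ≤ 16 * M * volume.real (capRegion A t δ) := by
    intro x hx
    have := mul_abs_inner_le_volume (convex_capRegion hA.convex t δ) (by positivity) hw hx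
      (hA.volume_capRegion_ne_top t δ) t
    rw [div_mul_eq_mul_div, div_le_iff₀ (by positivity)] at this
    linarith
  have h1 := key x hx
  have h2 := key y hy
  have h3 : |⟪dir (t + Real.pi / 2), x - y⟫| ≤ |⟪dir (t + Real.pi / 2), x - w⟫|
      + |⟪dir (t + Real.pi / 2), y - w⟫| := by
    rw [← sub_sub_sub_cancel_right x y w, inner_sub_right]
    exact abs_sub _ _
  have := mul_le_mul_of_nonneg_left h3 (by positivity : 0 ≤ δ * r)
  linarith

lemma sq_le_area (hA : IsBodyBetween A r M) (t : ℝ) {δ : ℝ} (hδ : 0 < δ)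
    (hδM : δ ≤ M) : δ ^ 2 * r ^ 2 ≤ 64 * M ^ 2 * volume.real (capRegion A t δ) := by
  have hr := hA.pos
  have hM : 0 < M := hr.trans_le hA.le
  -- The triangle bound applies to a boundary point of the disc itself.
  obtain ⟨w, hw⟩ := hA.exists_disc_subset_capRegion t hδ hδM
  set ρ := δ * r / (4 * M) with hρ
  have hρ0 : 0 ≤ ρ := by positivity
  have := mul_abs_inner_le_volume (convex_capRegion hA.convex t δ) hρ0 hw
    (hw (ρ • dir (t + Real.pi / 2)) (by simp [norm_smul, norm_dir, abs_of_nonneg hρ0]))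
    (hA.volume_capRegion_ne_top t δ) t
  rw [add_sub_cancel_left, inner_smul_right, real_inner_self_eq_norm_sq, norm_dir, one_pow, mul_one,
    abs_of_nonneg hρ0] at this
  have e : ρ * ρ * (16 * M ^ 2) = δ ^ 2 * r ^ 2 := by rw [hρ]; field_simp; ring
  nlinarith [mul_le_mul_of_nonneg_right this (by positivity : 0 ≤ 16 * M ^ 2)]

lemma area_pos (hA : IsBodyBetween A r M) (t : ℝ) {δ : ℝ} (hδ : 0 < δ) (hδM : δ ≤ M) :
    0 < volume.real (capRegion A t δ) := by
  have hr := hA.pos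
  have h1 := hA.sq_le_area t hδ hδM
  have h2 : 0 < δ ^ 2 * r ^ 2 := by positivity
  by_contra h
  nlinarith [sq_nonneg M]

end IsBodyBetween

/-- The radius of the arc of directions about `t` attached to `capRegion A t δ`: a small multiple of
`δ ^ 2` over the area of the cap, that is, of its width divided by its length. The factor is small
enough that directions in the fivefold arc are supported inside the cap. -/
def arcRadius (A : Set Plane) (r M δ t : ℝ) : ℝ :=
  r ^ 2 / (1000 * M ^ 2) * (δ ^ 2 / volume.real (capRegion A t δ))

namespace IsBodyBetween

variable {A : Set Plane} {r M : ℝ}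

lemma arcRadius_pos (hA : IsBodyBetween A r M) (t : ℝ) {δ : ℝ} (hδ : 0 < δ) (hδM : δ ≤ M) :
    0 < arcRadius A r M δ t := by
  have hr := hA.pos
  have hM : 0 < M := hr.trans_le hA.le
  have := hA.area_pos t hδ hδM
  unfold arcRadius
  positivity

lemma five_mul_arcRadius_le (hA : IsBodyBetween A r M) (t : ℝ) {δ : ℝ} (hδ : 0 < δ)
    (hδM : δ ≤ M) : 5 * arcRadius A r M δ t ≤ 1 := by
  have hr := hA.pos
  have hM : 0 < M := hr.trans_le hA.le
  have h1 := hA.area_pos t hδ hδM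
  have h2 := hA.sq_le_area t hδ hδM
  unfold arcRadius
  rw [div_mul_div_comm, ← mul_div_assoc, div_le_one (by positivity)]
  nlinarith

lemma arcRadius_mul_area (hA : IsBodyBetween A r M) (t : ℝ) {δ : ℝ} (hδ : 0 < δ)
    (hδM : δ ≤ M) :
    arcRadius A r M δ t * volume.real (capRegion A t δ) = r ^ 2 / (1000 * M ^ 2) * δ ^ 2 := by
  have h1 := hA.area_pos t hδ hδM
  unfold arcRadius
  field_simp

lemma arcRadius_mul_abs_inner_le (hA : IsBodyBetween A r M) (t : ℝ) {δ : ℝ} (hδ : 0 < δ)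
    (hδM : δ ≤ M) {x y : Plane} (hx : x ∈ capRegion A t δ) (hy : y ∈ capRegion A t δ) :
    arcRadius A r M δ t * |⟪dir (t + Real.pi / 2), x - y⟫| ≤ 4 * δ / 125 := by
  have hr := hA.pos
  have hM : 0 < M := hr.trans_le hA.le
  have h1 := hA.area_pos t hδ hδM
  have h2 := hA.abs_inner_sub_le_area t hδ hδM hx hy
  have h3 := hA.le
  have h4 : |⟪dir (t + Real.pi / 2), x - y⟫|
      ≤ 32 * M * volume.real (capRegion A t δ) / (δ * r) := by
    rw [le_div_iff₀ (by positivity)]; linarith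
  calc _ ≤ arcRadius A r M δ t * (32 * M * volume.real (capRegion A t δ) / (δ * r)) :=
        mul_le_mul_of_nonneg_left h4 (hA.arcRadius_pos t hδ hδM).le
    _ = 32 * δ / 1000 * (r / M) := by unfold arcRadius; field_simp
    _ ≤ 32 * δ / 1000 * 1 := by gcongr; rwa [div_le_one hM]
    _ = _ := by ring

/-- Normals close to `dir t` support `A` inside the cap in direction `t`. If a point of support
were deeper, the point of depth `δ / 2` on the segment to it would already be too far away. -/
lemma mem_capRegion_of_support (hA : IsBodyBetween A r M) {t τ δ : ℝ} (hδ : 0 < δ)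
    (hδM : δ ≤ M) (hτ : |τ| ≤ 5 * arcRadius A r M δ t) {p : Plane} (hp : p ∈ A)
    (hps : ⟪dir (t + τ), p⟫ = supportFn A (t + τ)) : p ∈ capRegion A t (δ / 2) := by
  obtain ⟨q, hq, hqs⟩ := exists_inner_eq_supportFn hA.isCompact hA.nonempty t
  refine ⟨hp, ?_⟩
  by_contra! hlt
  set d := supportFn A t - ⟪dir t, p⟫ with hd
  have hdδ : δ / 2 < d := by rw [hd]; linarith
  have hd0 : 0 < d := by linarith
  set s := δ / (2 * d) with hs
  have hs0 : 0 < s := by positivity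
  have hsd : s * d = δ / 2 := by rw [hs]; field_simp
  have hs1 : s ≤ 1 := by rw [hs, div_le_one (by positivity)]; linarith
  have hz : (1 - s) • q + s • p ∈ capRegion A t δ := by
    refine ⟨hA.convex hq hp (by linarith) hs0.le (by ring), ?_⟩
    rw [inner_add_right, inner_smul_right, inner_smul_right, hqs]
    nlinarith
  have hqR : q ∈ capRegion A t δ := ⟨hq, by rw [hqs]; linarith⟩
  have h1 := hA.arcRadius_mul_abs_inner_le t hδ hδM hz hqR
  have e1 : (1 - s) • q + s • p - q = s • (p - q) := by module
  rw [e1, inner_smul_right, abs_mul, abs_of_pos hs0] at h1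
  have h2 : ⟪dir (t + τ), q⟫ ≤ ⟪dir (t + τ), p⟫ := by
    rw [hps]; exact inner_le_supportFn hA.isCompact _ hq
  have h3 : 0 ≤ ⟪dir (t + τ), p - q⟫ := by rw [inner_sub_right]; linarith
  rw [inner_dir_add, inner_sub_right (dir t), hqs] at h3
  have hτ1 : |τ| ≤ 1 := hτ.trans (hA.five_mul_arcRadius_le t hδ hδM)
  have hcos : 1 / 2 ≤ Real.cos τ := by
    have h6 := Real.one_sub_sq_div_two_le_cos (x := τ)
    have h7 : τ ^ 2 ≤ 1 := (sq_le_one_iff_abs_le_one τ).2 hτ1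
    linarith
  set g := ⟪dir (t + Real.pi / 2), p - q⟫ with hg
  have h4 : Real.sin τ * g ≤ |τ| * |g| := by
    calc _ ≤ |Real.sin τ * g| := le_abs_self _
      _ = |Real.sin τ| * |g| := abs_mul _ _
      _ ≤ _ := mul_le_mul_of_nonneg_right Real.abs_sin_le_abs (abs_nonneg _)
  have h5 : d / 2 ≤ |τ| * |g| := by nlinarith
  have h6 : |τ| * |g| ≤ 5 * (arcRadius A r M δ t * |g|) := by
    nlinarith [abs_nonneg g]
  nlinarith

/-- Caps in nearby directions are comparable. -/
lemma capRegion_subset (hA : IsBodyBetween A r M) {t τ δ : ℝ} (hδ : 0 < δ)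
    (hδM : δ ≤ M) (hτ : |τ| ≤ arcRadius A r M δ t) :
    capRegion A t δ ⊆ capRegion A (t + τ) (2 * δ) := by
  intro x hx
  refine ⟨hx.1, ?_⟩
  obtain ⟨p, hp, hps⟩ := exists_inner_eq_supportFn hA.isCompact hA.nonempty (t + τ)
  have hθ := hA.arcRadius_pos t hδ hδM
  have hpR' := hA.mem_capRegion_of_support hδ hδM (hτ.trans (by linarith)) hp hps
  have hpR : p ∈ capRegion A t δ := ⟨hp, by linarith [hpR'.2]⟩
  have h1 := hA.arcRadius_mul_abs_inner_le t hδ hδM hpR hx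
  set g := ⟪dir (t + Real.pi / 2), p - x⟫ with hg
  have h2 := inner_dir_add t τ (p - x)
  rw [inner_sub_right, hps, ← hg] at h2
  have h3 : ⟪dir t, p - x⟫ ≤ δ := by
    rw [inner_sub_right]
    linarith [inner_le_supportFn hA.isCompact t hp, hx.2]
  have hτ1 : |τ| ≤ 1 := by linarith [hA.five_mul_arcRadius_le t hδ hδM]
  have hcos : 0 ≤ Real.cos τ :=
    Real.cos_nonneg_of_neg_pi_div_two_le_of_le (by linarith [(abs_le.1 hτ1).1, Real.pi_gt_three])
      (by linarith [(abs_le.1 hτ1).2, Real.pi_gt_three])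
  have h4 : Real.sin τ * g ≤ |τ| * |g| := by
    calc _ ≤ |Real.sin τ * g| := le_abs_self _
      _ = |Real.sin τ| * |g| := abs_mul _ _
      _ ≤ _ := mul_le_mul_of_nonneg_right Real.abs_sin_le_abs (abs_nonneg _)
  have h6 : |τ| * |g| ≤ arcRadius A r M δ t * |g| := by gcongr
  nlinarith [Real.cos_le_one τ]

end IsBodyBetween

/-! ### Coverings by arcs and caps -/

/-- A Vitali covering of the circle of directions by arcs of radius `θ`, with the number of arcs
controlled by the integral of any function that is at least `a / θ t` on the arc about `t`. -/
lemma exists_finset_arcs_cover {θ : ℝ → ℝ} (hθ : ∀ t, 0 < θ t) (hθ1 : ∀ t, 5 * θ t ≤ 1)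
    {F : ℝ → ℝ≥0∞} {a B : ℝ≥0∞} (ha : a ≠ 0) (hB : B ≠ ∞)
    (hF : ∀ t s, |s - t| ≤ θ t → a ≤ ENNReal.ofReal (θ t) * F s)
    (hint : ∫⁻ s in Set.Ioo (-Real.pi) Real.pi, F s ≤ B) :
    ∃ u : Finset ℝ, (∀ t ∈ Set.Icc (-Real.pi) Real.pi, ∃ b ∈ u, |t - b| ≤ 5 * θ b) ∧
      u.card * a ≤ B := by
  obtain ⟨u, hut, hdisj, hcov⟩ := Vitali.exists_disjoint_subfamily_covering_enlargement_closedBall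
    (Set.Icc (-Real.pi) Real.pi) (fun t : ℝ => t) θ 1 (fun t _ => by linarith [hθ1 t, hθ t]) 5
    (by norm_num)
  -- At least half of an arc about a point of `[-π, π]` lies in `(-π, π)`.
  have harc : ∀ b ∈ u, a ≤
      ∫⁻ s in Metric.closedBall b (θ b) ∩ Set.Ioo (-Real.pi) Real.pi, F s := by
    intro b hb
    obtain ⟨hb1, hb2⟩ := hut hb
    have hpi := Real.pi_gt_three
    have h0 := hθ b
    have h1 := hθ1 b
    have hvol : ENNReal.ofReal (θ b)
        ≤ volume (Metric.closedBall b (θ b) ∩ Set.Ioo (-Real.pi) Real.pi) := by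
      have hsub : Set.Ioo (max (b - θ b) (-Real.pi)) (min (b + θ b) Real.pi)
          ⊆ Metric.closedBall b (θ b) ∩ Set.Ioo (-Real.pi) Real.pi := by
        rintro s ⟨hs1, hs2⟩
        rw [max_lt_iff] at hs1
        rw [lt_min_iff] at hs2
        refine ⟨?_, hs1.2, hs2.2⟩
        rw [Metric.mem_closedBall, Real.dist_eq, abs_le]
        constructor <;> linarith
      refine le_trans ?_ (measure_mono hsub)
      rw [Real.volume_Ioo]
      apply ENNReal.ofReal_le_ofReal
      rcases max_choice (b - θ b) (-Real.pi) with h | h <;>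
        rcases min_choice (b + θ b) Real.pi with h' | h' <;> rw [h, h'] <;> linarith
    calc a ≤ (a / ENNReal.ofReal (θ b)) * ENNReal.ofReal (θ b) := by
          rw [ENNReal.div_mul_cancel (by simpa using h0) ENNReal.ofReal_ne_top]
      _ ≤ (a / ENNReal.ofReal (θ b))
          * volume (Metric.closedBall b (θ b) ∩ Set.Ioo (-Real.pi) Real.pi) := by gcongr
      _ = ∫⁻ _ in Metric.closedBall b (θ b) ∩ Set.Ioo (-Real.pi) Real.pi,
          a / ENNReal.ofReal (θ b) := by rw [setLIntegral_const]
      _ ≤ _ := by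
        refine setLIntegral_mono' (Metric.isClosed_closedBall.measurableSet.inter
          measurableSet_Ioo) fun s hs => ?_
        apply ENNReal.div_le_of_le_mul'
        exact hF b s (by simpa [Real.dist_eq] using hs.1)
  have hcard : ∀ s : Finset ℝ, ↑s ⊆ u → s.card * a ≤ B := by
    intro s hs
    calc (s.card : ℝ≥0∞) * a = ∑ b ∈ s, a := by simp
      _ ≤ ∑ b ∈ s, ∫⁻ s in Metric.closedBall b (θ b) ∩ Set.Ioo (-Real.pi) Real.pi, F s :=
        Finset.sum_le_sum fun b hb => harc b (hs hb)
      _ = ∫⁻ s in ⋃ b ∈ s, Metric.closedBall b (θ b) ∩ Set.Ioo (-Real.pi) Real.pi, F s := by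
        rw [lintegral_biUnion_finset]
        · exact fun b hb c hc hbc => (hdisj (hs hb) (hs hc) hbc).mono Set.inter_subset_left
            Set.inter_subset_left
        · exact fun b _ => Metric.isClosed_closedBall.measurableSet.inter measurableSet_Ioo
      _ ≤ ∫⁻ s in Set.Ioo (-Real.pi) Real.pi, F s :=
        lintegral_mono_set (Set.iUnion₂_subset fun _ _ => Set.inter_subset_right)
      _ ≤ B := hint
  have hfin : u.Finite := by
    by_contra hinf
    obtain ⟨n, hn⟩ := ENNReal.exists_nat_mul_gt ha hB
    obtain ⟨s, hs, hsn⟩ := Set.Infinite.exists_subset_card_eq hinf n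
    exact absurd (hcard s hs) (by rw [hsn]; exact not_le.2 hn)
  refine ⟨hfin.toFinset, fun t ht => ?_, hcard _ (by simp)⟩
  obtain ⟨b, hb, hsub⟩ := hcov t ht
  refine ⟨b, by simpa using hb, ?_⟩
  simpa [Real.dist_eq] using hsub (Metric.mem_closedBall_self (hθ t).le)

lemma mem_frontier_of_inner_eq_supportFn {Ω : Set Plane} (hopen : IsOpen Ω)
    (hcpt : IsCompact (closure Ω)) {t : ℝ} {q : Plane} (hq : q ∈ closure Ω)
    (hqs : ⟪dir t, q⟫ = supportFn (closure Ω) t) : q ∈ frontier Ω := by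
  rw [hopen.frontier_eq]
  refine ⟨hq, fun hqΩ => ?_⟩
  have hcont : Tendsto (fun ε : ℝ => q + ε • dir t) (𝓝[>] 0) (𝓝 q) := by
    have : Continuous fun ε : ℝ => q + ε • dir t := by fun_prop
    simpa using (this.tendsto 0).mono_left nhdsWithin_le_nhds
  obtain ⟨ε, hε, hε0⟩ :=
    ((hcont.eventually (hopen.mem_nhds hqΩ)).and self_mem_nhdsWithin).exists
  have h := inner_le_supportFn hcpt t (subset_closure hε)
  rw [inner_add_right, hqs, inner_smul_right, real_inner_self_eq_norm_sq, norm_dir] at h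
  have hε0 : 0 < ε := hε0
  linarith

lemma exists_dir_support_of_mem_frontier {Ω : Set Plane} (hopen : IsOpen Ω) (hconv : Convex ℝ Ω)
    (h0 : (0 : Plane) ∈ Ω) (hcpt : IsCompact (closure Ω)) {x : Plane} (hx : x ∈ frontier Ω) :
    ∃ t ∈ Set.Icc (-Real.pi) Real.pi, ⟪dir t, x⟫ = supportFn (closure Ω) t := by
  rw [hopen.frontier_eq] at hx
  obtain ⟨f, hf⟩ := geometric_hahn_banach_open_point hconv hopen hx.2
  set n := (InnerProductSpace.toDual ℝ Plane).symm f with hn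
  have hfn : ∀ y, f y = ⟪n, y⟫ := fun y => by rw [hn, InnerProductSpace.toDual_symm_apply]
  have hn0 : n ≠ 0 := by
    intro h
    have := hf 0 h0
    simp [hfn, h] at this
  have hn0' : 0 < ‖n‖ := norm_pos_iff.2 hn0
  obtain ⟨t, ht, htn⟩ := exists_eq_dir (‖n‖⁻¹ • n) (norm_smul_inv_norm (𝕜 := ℝ) hn0)
  refine ⟨t, ht, le_antisymm (inner_le_supportFn hcpt t hx.1) ?_⟩
  obtain ⟨q, hq, hqs⟩ := exists_inner_eq_supportFn hcpt ⟨x, hx.1⟩ t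
  rw [← hqs, ← htn]
  have hcl : closure Ω ⊆ {y | ⟪‖n‖⁻¹ • n, y⟫ ≤ ⟪‖n‖⁻¹ • n, x⟫} := by
    refine closure_minimal (fun y hy => ?_) (isClosed_le (by fun_prop) continuous_const)
    simp only [Set.mem_ofPred_eq, real_inner_smul_left]
    have := (hf y hy).le
    rw [hfn, hfn] at this
    gcongr
  exact hcl hq

lemma mem_cap_of_mem_capRegion {Ω : Set Plane} {t δ : ℝ} (hδ : 0 < δ)
    {q x : Plane} (hqs : ⟪dir t, q⟫ = supportFn (closure Ω) t) (hcpt : IsCompact (closure Ω))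
    (hx : x ∈ frontier Ω) (hxR : x ∈ capRegion (closure Ω) t (δ / 2)) :
    x ∈ cap Ω {y | ⟪dir t, y⟫ = ⟪dir t, q⟫} δ := by
  refine ⟨hx, ?_⟩
  set d := ⟪dir t, q⟫ - ⟪dir t, x⟫ with hd
  have hd0 : 0 ≤ d := by
    have := inner_le_supportFn hcpt t hxR.1
    rw [hd, hqs]; linarith
  have hd1 : d ≤ δ / 2 := by
    have := hxR.2
    rw [hd, hqs]; linarith
  have hmem : x + d • dir t ∈ {y | ⟪dir t, y⟫ = ⟪dir t, q⟫} := by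
    simp only [Set.mem_ofPred_eq, inner_add_right, inner_smul_right, real_inner_self_eq_norm_sq,
      norm_dir]
    rw [hd]; ring
  calc Metric.infDist x _ ≤ dist x (x + d • dir t) := Metric.infDist_le_dist_of_mem hmem
    _ = d := by simp [dist_eq_norm, norm_smul, norm_dir, abs_of_nonneg hd0]
    _ < δ := by linarith

/-- Arcs of directions about the points of `u` that cover the circle yield a cover of the boundary
by caps. -/
lemma coverNum_le_card {Ω : Set Plane} (hopen : IsOpen Ω) (hconv : Convex ℝ Ω)
    (h0 : (0 : Plane) ∈ Ω) {r M δ : ℝ} (hA : IsBodyBetween (closure Ω) r M) (hδ : 0 < δ)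
    (hδM : δ ≤ M) (u : Finset ℝ) (hu : ∀ t ∈ Set.Icc (-Real.pi) Real.pi,
      ∃ b ∈ u, |t - b| ≤ 5 * arcRadius (closure Ω) r M δ b) : coverNum Ω δ ≤ u.card := by
  classical
  choose q hq hqs using fun t => exists_inner_eq_supportFn hA.isCompact hA.nonempty t
  set S : Finset (Set Plane) := u.image fun b => cap Ω {y | ⟪dir b, y⟫ = ⟪dir b, q b⟫} δ with hS
  have hcov : coverNum Ω δ ≤ S.card := by
    apply Nat.sInf_le
    refine ⟨S, ?_, ?_, rfl⟩
    · intro B hB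
      obtain ⟨b, -, rfl⟩ := Finset.mem_image.1 (Finset.mem_coe.1 hB)
      refine ⟨q b, mem_frontier_of_inner_eq_supportFn hopen hA.isCompact (hq b) (hqs b), _,
        ⟨dir b, norm_dir b, rfl, fun x hx => ?_⟩, rfl⟩
      rw [hqs b]
      exact inner_le_supportFn hA.isCompact b (subset_closure hx)
    · intro x hx
      obtain ⟨t, ht, hts⟩ := exists_dir_support_of_mem_frontier hopen hconv h0 hA.isCompact hx
      obtain ⟨b, hb, hbt⟩ := hu t ht
      refine ⟨_, Finset.mem_coe.2 (Finset.mem_image_of_mem _ hb),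
        mem_cap_of_mem_capRegion hδ (hqs b) hA.isCompact hx ?_⟩
      exact hA.mem_capRegion_of_support hδ hδM hbt (frontier_subset_closure hx) (by simpa using hts)
  exact hcov.trans Finset.card_image_le

/-! ### The multiplier -/

lemma multiplier_nonneg (Ω : Set Plane) (lam : ℝ) (ξ : Plane) : 0 ≤ multiplier Ω lam ξ := by
  unfold multiplier
  split_ifs
  · exact Set.indicator_nonneg (fun _ _ => zero_le_one) _
  · positivity

lemma multiplier_le_one (Ω : Set Plane) {lam : ℝ} (hlam : 0 ≤ lam) (ξ : Plane) :
    multiplier Ω lam ξ ≤ 1 := by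
  unfold multiplier
  split_ifs
  · exact Set.indicator_le_self' (fun _ _ => zero_le_one) _
  · exact Real.rpow_le_one (le_max_right _ _)
      (max_le (by linarith [gauge_nonneg (s := Ω) ξ]) zero_le_one) hlam

lemma measurable_multiplier {Ω : Set Plane} (hopen : IsOpen Ω) (hconv : Convex ℝ Ω)
    (h0 : (0 : Plane) ∈ Ω) (lam : ℝ) : Measurable (multiplier Ω lam) := by
  unfold multiplier
  split_ifs
  · exact measurable_const.indicator hopen.measurableSet
  · have : Measurable (gauge Ω) :=
      (continuous_gauge hconv (hopen.mem_nhds h0)).measurable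
    fun_prop

lemma multiplier_eq_zero {Ω : Set Plane} (hopen : IsOpen Ω) (hconv : Convex ℝ Ω)
    (h0 : (0 : Plane) ∈ Ω) (lam : ℝ) {ξ : Plane} (hξ : ξ ∉ Ω) : multiplier Ω lam ξ = 0 := by
  unfold multiplier
  split_ifs with h
  · exact Set.indicator_of_notMem hξ _
  · have : 1 ≤ gauge Ω ξ := by
      by_contra! hlt
      exact hξ (setOfPred_gauge_lt_one_subset_self hconv h0 (absorbent_nhds_zero (hopen.mem_nhds h0)) hlt)
    rw [max_eq_right (by linarith), Real.zero_rpow h]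

lemma integrable_multiplier {Ω : Set Plane} (hopen : IsOpen Ω) (hconv : Convex ℝ Ω)
    (h0 : (0 : Plane) ∈ Ω) (hbdd : Bornology.IsBounded Ω) {lam : ℝ} (hlam : 0 ≤ lam) :
    Integrable (multiplier Ω lam) := by
  have hind : Integrable (Ω.indicator fun _ => (1 : ℝ)) :=
    (integrable_indicator_iff hopen.measurableSet).2
      (integrableOn_const hbdd.measure_lt_top.ne)
  refine hind.mono' (measurable_multiplier hopen hconv h0 lam).aestronglyMeasurable
    (.of_forall fun ξ => ?_)
  rw [Real.norm_of_nonneg (multiplier_nonneg _ _ _)]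
  by_cases hξ : ξ ∈ Ω
  · rw [Set.indicator_of_mem hξ]; exact multiplier_le_one Ω hlam ξ
  · rw [multiplier_eq_zero hopen hconv h0 lam hξ, Set.indicator_of_notMem hξ]

lemma rpow_le_multiplier_smul {Ω : Set Plane} (hopen : IsOpen Ω) (hconv : Convex ℝ Ω)
    (h0 : (0 : Plane) ∈ Ω) {lam δ : ℝ} (hlam : 0 ≤ lam) (hδ : 0 < δ) (hδ1 : δ ≤ 1) {x : Plane}
    (hx : x ∈ closure Ω) : δ ^ lam ≤ multiplier Ω lam ((1 - δ) • x) := by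
  have hg : gauge Ω x ≤ 1 :=
    (gauge_le_one_iff_mem_closure hconv (hopen.mem_nhds h0)).2 hx
  have hg' : gauge Ω ((1 - δ) • x) ≤ 1 - δ := by
    rw [gauge_smul_of_nonneg (by linarith), smul_eq_mul]
    nlinarith
  unfold multiplier
  split_ifs with h
  · rw [Set.indicator_of_mem, h, Real.rpow_zero]
    exact setOfPred_gauge_lt_one_subset_self hconv h0 (absorbent_nhds_zero (hopen.mem_nhds h0))
      (show gauge Ω _ < 1 by linarith)
  · exact Real.rpow_le_rpow hδ.le (le_max_of_le_left (by linarith)) hlam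

open scoped Pointwise in
/-- The lower bound is the contribution of the cap in direction `t`, contracted by `1 - δ`. -/
lemma le_setIntegral_multiplier {Ω : Set Plane} (hopen : IsOpen Ω) (hconv : Convex ℝ Ω)
    (h0 : (0 : Plane) ∈ Ω) (hbdd : Bornology.IsBounded Ω) {r M δ lam t τ : ℝ}
    (hA : IsBodyBetween (closure Ω) r M) (hlam : 0 ≤ lam) (hδ : 0 < δ)
    (hδM : δ ≤ M) (hδ1 : δ ≤ 1 / 2) (hτ : |τ| ≤ arcRadius (closure Ω) r M δ t) :
    δ ^ lam * (volume.real (capRegion (closure Ω) t δ) / 4) ≤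
      ∫ ξ in capRegion (closure Ω) (t + τ) ((2 + M) * δ), multiplier Ω lam ξ := by
  set R := capRegion (closure Ω) t δ with hR
  have hint := integrable_multiplier hopen hconv h0 hbdd hlam
  have hRc : IsCompact ((1 - δ) • R) := (isCompact_capRegion hA.isCompact t δ).smul (1 - δ)
  have hsub : (1 - δ) • R ⊆ capRegion (closure Ω) (t + τ) ((2 + M) * δ) := by
    rintro _ ⟨x, hx, rfl⟩
    have h2 := hA.capRegion_subset hδ hδM hτ hx
    refine ⟨?_, ?_⟩
    · have := hA.convex hx.1 (subset_closure h0) (by linarith : 0 ≤ 1 - δ) hδ.le (by ring)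
      simpa using this
    · simp only [inner_smul_right]
      have h3 := (abs_le.1 (hA.abs_inner_le hx.1 (t + τ))).2
      have h4 := h2.2
      nlinarith
  have hvol : volume.real ((1 - δ) • R) = (1 - δ) ^ 2 * volume.real R := by
    rw [Measure.real, Measure.addHaar_smul, finrank_euclideanSpace_fin, ENNReal.toReal_mul,
      ENNReal.toReal_ofReal (abs_nonneg _), abs_of_nonneg (by positivity), Measure.real]
  calc δ ^ lam * (volume.real R / 4) ≤ δ ^ lam * volume.real ((1 - δ) • R) := by
        rw [hvol]
        gcongr
        have h1 : 0 ≤ volume.real R := measureReal_nonneg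
        have h2 : 1 / 4 ≤ (1 - δ) ^ 2 := by nlinarith
        nlinarith
    _ ≤ ∫ ξ in (1 - δ) • R, multiplier Ω lam ξ := by
        refine setIntegral_ge_of_const_le_real hRc.measurableSet hRc.measure_lt_top.ne ?_
          hint.integrableOn
        rintro _ ⟨x, hx, rfl⟩
        exact rpow_le_multiplier_smul hopen hconv h0 hlam hδ (by linarith) hx.1
    _ ≤ _ := setIntegral_mono_set hint.integrableOn
        (.of_forall fun ξ => multiplier_nonneg Ω lam ξ) hsub.eventuallyLE

/-! ### The kernel along rays -/

lemma integrableOn_mul_exp_neg_mul_Ioi {δ : ℝ} (hδ : 0 < δ) :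
    IntegrableOn (fun R : ℝ => R * Real.exp (-(δ * R))) (Set.Ioi 0) := by
  have := integrableOn_rpow_mul_exp_neg_mul_rpow (p := 1) (s := 1) (by norm_num) one_pos hδ
  simpa using this

lemma integral_mul_cexp_neg_mul_Ioi {a : ℂ} (ha : 0 < a.re) :
    ∫ R in Set.Ioi (0 : ℝ), (R : ℂ) * Complex.exp (-(a * R)) = 1 / a ^ 2 := by
  have ha0 : a ≠ 0 := by rintro rfl; simp at ha
  have hnorm : ∀ R : ℝ, ‖Complex.exp (-(a * R))‖ = Real.exp (-(a.re * R)) := by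
    intro R; rw [Complex.norm_exp]; simp
  set G : ℝ → ℂ := fun R => -((R / a + 1 / a ^ 2) * Complex.exp (-(a * R))) with hG
  have hderiv : ∀ R ∈ Set.Ici (0 : ℝ),
      HasDerivAt G ((R : ℂ) * Complex.exp (-(a * R))) R := by
    intro R _
    have h1 : HasDerivAt (fun z : ℂ => -((z / a + 1 / a ^ 2) * Complex.exp (-(a * z))))
        (-((1 / a) * Complex.exp (-(a * R))
          + (R / a + 1 / a ^ 2) * (Complex.exp (-(a * R)) * (-(a * 1))))) R :=
      ((((hasDerivAt_id (R : ℂ)).div_const a).add_const _).mul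
        (((hasDerivAt_id (R : ℂ)).const_mul a).neg.cexp)).neg
    convert h1.comp_ofReal using 1
    field_simp
    ring
  have hint : IntegrableOn (fun R : ℝ => (R : ℂ) * Complex.exp (-(a * R))) (Set.Ioi 0) := by
    refine (integrableOn_mul_exp_neg_mul_Ioi ha).mono' ?_ ?_
    · exact (by fun_prop : Continuous fun R : ℝ =>
        (R : ℂ) * Complex.exp (-(a * R))).aestronglyMeasurable
    · filter_upwards [ae_restrict_mem measurableSet_Ioi] with R hR
      have hR : 0 < R := hR
      rw [norm_mul, hnorm, Complex.norm_real, Real.norm_of_nonneg hR.le]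
  have hlim : Tendsto G atTop (𝓝 0) := by
    have h0 := tendsto_rpow_mul_exp_neg_mul_atTop_nhds_zero 0 a.re ha
    have h1 := tendsto_rpow_mul_exp_neg_mul_atTop_nhds_zero 1 a.re ha
    have h2 := (h1.mul_const ‖a‖⁻¹).add (h0.mul_const (‖a‖ ^ 2)⁻¹)
    simp only [Real.rpow_one, Real.rpow_zero, one_mul, zero_mul, add_zero] at h2
    refine squeeze_zero_norm' ?_ h2
    filter_upwards [eventually_ge_atTop 0] with R hR
    rw [hG]
    simp only [norm_neg, norm_mul, hnorm]
    have h3 : ‖(R : ℂ) / a + 1 / a ^ 2‖ ≤ R * ‖a‖⁻¹ + (‖a‖ ^ 2)⁻¹ := by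
      refine (norm_add_le _ _).trans_eq ?_
      simp [abs_of_nonneg hR, div_eq_mul_inv]
    calc _ ≤ (R * ‖a‖⁻¹ + (‖a‖ ^ 2)⁻¹) * Real.exp (-(a.re * R)) := by gcongr
      _ = _ := by rw [neg_mul]; ring
  rw [integral_Ioi_of_hasDerivAt_of_tendsto' hderiv hint hlim, hG]
  simp

lemma integral_mul_exp_neg_mul_Ioi {δ : ℝ} (hδ : 0 < δ) :
    ∫ R in Set.Ioi (0 : ℝ), R * Real.exp (-(δ * R)) = 1 / δ ^ 2 := by
  have h := integral_mul_cexp_neg_mul_Ioi (a := δ) (by simpa using hδ)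
  have h2 : ∀ R : ℝ, (R : ℂ) * Complex.exp (-(δ * R))
      = ((R * Real.exp (-(δ * R)) : ℝ) : ℂ) := by intro R; push_cast; rfl
  simp only [h2] at h
  rw [integral_complex_ofReal] at h
  exact_mod_cast h

lemma re_I_div_sq (v : ℝ) :
    (Complex.I / (1 + Complex.I * v) ^ 2).re = 2 * v / (1 + v ^ 2) ^ 2 := by
  have h1 : (1 + v ^ 2 : ℝ) ≠ 0 := by positivity
  have h2 : Complex.I / (1 + Complex.I * v) ^ 2
      = ((2 * v / (1 + v ^ 2) ^ 2 : ℝ) : ℂ)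
        + ((1 - v ^ 2) / (1 + v ^ 2) ^ 2 : ℝ) * Complex.I := by
    have h3 : (1 + Complex.I * v) ≠ 0 := by
      intro h
      have := congrArg Complex.re h
      simp at this
    have h4 : (1 + (v : ℂ) ^ 2) ≠ 0 := by exact_mod_cast h1
    push_cast
    field_simp
    ring_nf
    simp only [Complex.I_sq, show Complex.I ^ 3 = -Complex.I by rw [pow_succ, Complex.I_sq]; ring]
    ring
  rw [h2, Complex.add_re, Complex.ofReal_re, Complex.re_ofReal_mul, Complex.I_re, mul_zero,
    add_zero]

/-- A weighted integral of the inverse Fourier transform of `g` along a ray, with a phase adapted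
to the supporting line at height `h`. The factor `i` makes the real part of the transformed weight
nonnegative as long as the argument `v` is. -/
lemma ofReal_integral_le_lintegral_ray {g : Plane → ℝ} (hg : Integrable g) (t h : ℝ) {δ : ℝ}
    (hδ : 0 < δ) :
    ENNReal.ofReal (∫ ξ, g ξ * (2 * (2 * Real.pi * (h - ⟪dir t, ξ⟫) / δ + 1)
        / (1 + (2 * Real.pi * (h - ⟪dir t, ξ⟫) / δ + 1) ^ 2) ^ 2)) ≤
      ∫⁻ R in Set.Ioi (0 : ℝ), ‖𝓕⁻ (fun ξ => (g ξ : ℂ)) (R • dir t)‖ₑ *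
        ENNReal.ofReal (δ ^ 2 * (R * Real.exp (-(δ * R)))) := by
  set v : Plane → ℝ := fun ξ => 2 * Real.pi * (h - ⟪dir t, ξ⟫) / δ + 1 with hv
  have hvcont : Continuous v := by rw [hv]; fun_prop
  set w : ℝ → ℂ := fun R => (R : ℂ) * Complex.exp (-(δ * R)) with hw
  have hwint : IntegrableOn w (Set.Ioi 0) := by
    have : w = fun R : ℝ => ((R * Real.exp (-(δ * R)) : ℝ) : ℂ) := by
      funext R; rw [hw]; push_cast; rfl
    rw [this]
    exact (integrableOn_mul_exp_neg_mul_Ioi hδ).ofReal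
  -- The integrand on the product of frequency space and the ray.
  set Φ : Plane → ℝ → ℂ := fun ξ R =>
    Complex.exp (-(δ * R * v ξ : ℝ) * Complex.I) * ((g ξ : ℂ) * w R) with hΦ
  have hΦint : Integrable (Function.uncurry Φ)
      ((volume : Measure Plane).prod (volume.restrict (Set.Ioi (0 : ℝ)))) := by
    have h1 := (hg.ofReal (𝕜 := ℂ)).mul_prod (hwint : Integrable w (volume.restrict (Set.Ioi 0)))
    refine Integrable.bdd_mul (c := 1) h1 ?_ (.of_forall fun z => ?_)
    · apply Continuous.aestronglyMeasurable
      fun_prop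
    · rw [Complex.norm_exp]; simp
  have hinner : ∀ ξ, ∫ R in Set.Ioi (0 : ℝ), Φ ξ R
      = (g ξ : ℂ) * (1 / (δ : ℂ) ^ 2 / (1 + Complex.I * v ξ) ^ 2) := by
    intro ξ
    have h1 := integral_mul_cexp_neg_mul_Ioi (a := δ * (1 + Complex.I * v ξ)) (by simpa using hδ)
    rw [mul_pow, ← div_div] at h1
    rw [← h1, ← integral_const_mul]
    congr 1
    funext R
    rw [hΦ, hw]
    simp only
    rw [mul_left_comm, mul_left_comm (Complex.exp _), ← Complex.exp_add]
    congr 3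
    push_cast
    ring
  have houter : ∀ R, ∫ ξ, Φ ξ R
      = 𝓕⁻ (fun ξ => (g ξ : ℂ)) (R • dir t)
        * (Complex.exp (-(2 * Real.pi * h + δ) * R * Complex.I : ℂ) * w R) := by
    intro R
    rw [Real.fourierInv_eq', ← integral_mul_const]
    congr 1
    funext ξ
    rw [hΦ]
    simp only [smul_eq_mul]
    rw [show Complex.exp (-(δ * R * v ξ : ℝ) * Complex.I)
      = Complex.exp (↑(2 * Real.pi * ⟪ξ, R • dir t⟫) * Complex.I)
        * Complex.exp (-(2 * Real.pi * h + δ) * R * Complex.I : ℂ) from ?_]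
    · ring
    rw [← Complex.exp_add, ← add_mul, inner_smul_right, real_inner_comm]
    congr 2
    have : δ * v ξ = 2 * Real.pi * (h - ⟪dir t, ξ⟫) + δ := by
      rw [hv]; field_simp
    rw [show δ * R * v ξ = R * (δ * v ξ) by ring, this]
    push_cast
    ring
  have hswap := integral_integral_swap hΦint
  simp only [hinner, houter] at hswap
  have hre : ∫ ξ, g ξ * (2 * v ξ / (1 + v ξ ^ 2) ^ 2)
      = (Complex.I * δ ^ 2
        * ∫ ξ, (g ξ : ℂ) * (1 / (δ : ℂ) ^ 2 / (1 + Complex.I * v ξ) ^ 2)).re := by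
    have hint : Integrable fun ξ => Complex.I * δ ^ 2
        * ((g ξ : ℂ) * (1 / (δ : ℂ) ^ 2 / (1 + Complex.I * v ξ) ^ 2)) := by
      have := hΦint.integral_prod_left
      simp only [Function.uncurry_apply_pair, hinner] at this
      exact this.const_mul _
    rw [← integral_const_mul]
    refine Eq.trans ?_ (integral_re hint)
    congr 1
    funext ξ
    rw [← re_I_div_sq]
    have hδ' : (δ : ℂ) ≠ 0 := by exact_mod_cast hδ.ne'
    rw [show Complex.I * δ ^ 2 * ((g ξ : ℂ) * (1 / (δ : ℂ) ^ 2 / (1 + Complex.I * v ξ) ^ 2))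
      = (g ξ : ℂ) * (Complex.I / (1 + Complex.I * v ξ) ^ 2) by field_simp]
    exact (Complex.re_ofReal_mul _ _).symm
  rw [hre, hswap, ← integral_const_mul]
  refine (ENNReal.ofReal_le_ofReal (Complex.re_le_norm _)).trans ?_
  rw [ofReal_norm]
  refine (enorm_integral_le_lintegral_enorm _).trans (setLIntegral_mono' measurableSet_Ioi
    fun R hR => le_of_eq ?_)
  have hR : 0 < R := hR
  have hphase : ‖Complex.exp (-(2 * Real.pi * h + δ) * R * Complex.I : ℂ)‖ = 1 := by
    have := Complex.norm_exp_ofReal_mul_I (-(2 * Real.pi * h + δ) * R)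
    push_cast at this
    exact this
  have hwn : ‖w R‖ = R * Real.exp (-(δ * R)) := by
    rw [hw]
    simp only [norm_mul, Complex.norm_real, Complex.norm_exp]
    rw [Real.norm_of_nonneg hR.le]
    simp
  rw [← ofReal_norm, ← ofReal_norm, ← ENNReal.ofReal_mul (norm_nonneg _)]
  congr 1
  rw [norm_mul, norm_mul, norm_mul, norm_mul, hphase, hwn]
  simp
  ring

/-! ### Polar coordinates -/

/-- Integration in polar coordinates. -/
lemma lintegral_polar {F : Plane → ℝ≥0∞} (hF : Measurable F) :
    ∫⁻ t in Set.Ioo (-Real.pi) Real.pi, ∫⁻ R in Set.Ioi (0 : ℝ),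
      ENNReal.ofReal R * F (R • dir t) = ∫⁻ x, F x := by
  set e : ℝ × ℝ → Plane := fun z => !₂[z.1, z.2] with he
  have hmp : MeasurePreserving e :=
    (PiLp.volume_preserving_toLp (Fin 2)).comp (volume_preserving_finTwoArrow ℝ).symm
  have hdir : ∀ z : ℝ × ℝ, e (polarCoord.symm z) = z.1 • dir z.2 := by
    intro z
    ext i
    fin_cases i <;> simp [he, dir, polarCoord_symm_apply]
  rw [← hmp.lintegral_comp hF, ← lintegral_comp_polarCoord_symm]
  simp only [hdir, polarCoord_target]
  have hd : Measurable dir := by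
    have : Continuous dir := by unfold dir; fun_prop
    exact this.measurable
  rw [Measure.volume_eq_prod, setLIntegral_prod_symm]
  · rfl
  · apply Measurable.aemeasurable
    fun_prop

lemma lintegral_exp_neg_mul_norm {δ : ℝ} (hδ : 0 < δ) :
    ∫⁻ x : Plane, ENNReal.ofReal (Real.exp (-(δ * ‖x‖)))
      = ENNReal.ofReal (2 * Real.pi / δ ^ 2) := by
  rw [← lintegral_polar (by fun_prop)]
  have : ∀ t : ℝ, ∫⁻ R in Set.Ioi (0 : ℝ),
      ENNReal.ofReal R * ENNReal.ofReal (Real.exp (-(δ * ‖R • dir t‖)))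
      = ENNReal.ofReal (1 / δ ^ 2) := by
    intro t
    rw [← integral_mul_exp_neg_mul_Ioi hδ, ofReal_integral_eq_lintegral_ofReal
      (integrableOn_mul_exp_neg_mul_Ioi hδ)]
    · refine setLIntegral_congr_fun measurableSet_Ioi fun R hR => ?_
      have hR : 0 < R := hR
      simp only [norm_smul, norm_dir, mul_one, Real.norm_of_nonneg hR.le]
      rw [ENNReal.ofReal_mul hR.le]
    · filter_upwards [ae_restrict_mem measurableSet_Ioi] with R hR
      have hR : 0 < R := hR
      exact mul_nonneg hR.le (Real.exp_nonneg _)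
  simp only [this, setLIntegral_const, Real.volume_Ioo]
  rw [← ENNReal.ofReal_mul (by positivity)]
  congr 1
  ring

/-- Hölder's inequality for the measure with density `exp (-δ ‖x‖)`. -/
lemma lintegral_enorm_mul_exp_le {K : Plane → ℂ} (hK : AEStronglyMeasurable K) {p δ : ℝ}
    (hp : 1 ≤ p) (hδ : 0 < δ) :
    ∫⁻ x, ‖K x‖ₑ * ENNReal.ofReal (Real.exp (-(δ * ‖x‖))) ≤
      eLpNorm K (ENNReal.ofReal p) volume * ENNReal.ofReal (2 * Real.pi / δ ^ 2) ^ (1 - 1 / p) := by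
  set d : Plane → ℝ≥0∞ := fun x => ENNReal.ofReal (Real.exp (-(δ * ‖x‖))) with hd
  have hdm : Measurable d := by rw [hd]; fun_prop
  have hle : (volume : Measure Plane).withDensity d ≤ volume := by
    have : d ≤ᵐ[volume] 1 := .of_forall fun x => by
      rw [hd]
      exact ENNReal.ofReal_le_one.2 (Real.exp_le_one_iff.2 (by have := norm_nonneg x; nlinarith))
    simpa using withDensity_mono this
  have huniv : (volume : Measure Plane).withDensity d Set.univ
      = ENNReal.ofReal (2 * Real.pi / δ ^ 2) := by
    rw [withDensity_apply _ MeasurableSet.univ, Measure.restrict_univ,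
      lintegral_exp_neg_mul_norm hδ]
  have h1 : (1 : ℝ≥0∞) ≤ ENNReal.ofReal p := by simpa using hp
  calc ∫⁻ x, ‖K x‖ₑ * d x = eLpNorm K 1 ((volume : Measure Plane).withDensity d) := by
        rw [eLpNorm_one_eq_lintegral_enorm, lintegral_withDensity_eq_lintegral_mul₀ hdm.aemeasurable
          hK.enorm]
        simp [mul_comm]
    _ ≤ eLpNorm K (ENNReal.ofReal p) ((volume : Measure Plane).withDensity d)
        * (volume : Measure Plane).withDensity d Set.univ ^ (1 / (1 : ℝ≥0∞).toReal
          - 1 / (ENNReal.ofReal p).toReal) :=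
      eLpNorm_le_eLpNorm_mul_rpow_measure_univ h1
        (hK.mono_ac (withDensity_absolutelyContinuous _ _))
    _ ≤ _ := by
      rw [huniv, ENNReal.toReal_one, ENNReal.toReal_ofReal (by linarith), div_one]
      gcongr

/-! ### Plancherel's theorem and the kernel -/

lemma integral_fourierInv_mul_eq (ψ : 𝓢(Plane, ℂ)) {g : Plane → ℂ} (hg : Integrable g) :
    ∫ ξ, (𝓕⁻ ψ : 𝓢(Plane, ℂ)) ξ • g ξ = ∫ x, ψ x • 𝓕⁻ g x := by
  have h := VectorFourier.integral_fourierIntegral_smul_eq_flip (μ := (volume : Measure Plane))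
    (ν := (volume : Measure Plane)) (L := -innerₗ Plane) (f := ψ) (g := g)
    Real.continuous_fourierChar (by simp only [LinearMap.neg_apply]; exact (continuous_inner).neg)
    (ψ.integrable (μ := volume)) hg
  have hflip : (-innerₗ Plane).flip = -innerₗ Plane := by
    ext x y; simp [real_inner_comm]
  rw [hflip] at h
  rw [SchwartzMap.fourierInv_coe]
  exact h

/-- Plancherel's theorem for the integral that defines `𝓕⁻` on `L¹ ∩ L²`. It follows from the
theorem for the abstract Fourier transform on `L²`, as both inverse transforms have the same
integrals against Schwartz functions. -/
lemma eLpNorm_two_fourierInv {g : Plane → ℂ} (hg : Integrable g) (hg2 : MemLp g 2) :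
    eLpNorm (𝓕⁻ g) 2 volume = eLpNorm g 2 volume := by
  set G : Lp ℂ 2 (volume : Measure Plane) := 𝓕⁻ (hg2.toLp g) with hG
  have hae : 𝓕⁻ g =ᵐ[volume] G := by
    have hcont : Continuous (𝓕⁻ g) :=
      VectorFourier.fourierIntegral_continuous Real.continuous_fourierChar
        (by simp only [LinearMap.neg_apply]; exact (continuous_inner).neg) hg
    refine ae_eq_of_integral_contDiff_smul_eq hcont.locallyIntegrable
      ((Lp.memLp G).locallyIntegrable (by norm_num)) fun φ hφ hφc => ?_
    have hφc' : HasCompactSupport fun x => (φ x : ℂ) := hφc.comp_left (g := ((↑) : ℝ → ℂ)) (by simp)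
    set ψ : 𝓢(Plane, ℂ) := hφc'.toSchwartzMap (Complex.ofRealCLM.contDiff.comp hφ) with hψ
    have hψφ : ∀ x, ψ x = (φ x : ℂ) := fun x => rfl
    have h1 := congrArg (fun D => D ψ) (Lp.fourierInv_toTemperedDistribution_eq (hg2.toLp g))
    simp only [TemperedDistribution.fourierInv_apply, Lp.toTemperedDistribution_apply] at h1
    have h2 : ∫ x, (𝓕⁻ ψ : 𝓢(Plane, ℂ)) x • (hg2.toLp g) x
        = ∫ x, (𝓕⁻ ψ : 𝓢(Plane, ℂ)) x • g x := by
      refine integral_congr_ae ?_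
      filter_upwards [hg2.coeFn_toLp] with x hx
      rw [hx]
    rw [h2, integral_fourierInv_mul_eq ψ hg] at h1
    simpa [hψφ, Complex.real_smul] using h1
  rw [eLpNorm_congr_ae hae, ← Lp.enorm_def, ← ofReal_norm, hG,
    show ‖(𝓕⁻ (hg2.toLp g) : Lp ℂ 2 (volume : Measure Plane))‖ = ‖hg2.toLp g‖ from
      (Lp.fourierTransformₗᵢ Plane ℂ).symm.norm_map _, ofReal_norm, Lp.enorm_toLp]

lemma eLpNorm_two_fourier (f : 𝓢(Plane, ℂ)) :
    eLpNorm (𝓕 (f : Plane → ℂ)) 2 volume = eLpNorm f 2 volume := by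
  have h := eLpNorm_two_fourierInv ((𝓕 f).integrable (μ := volume)) ((𝓕 f).memLp 2)
  rw [← SchwartzMap.fourierInv_coe, FourierTransform.fourierInv_fourier_eq] at h
  exact h.symm

lemma boundedOnLp_two {Ω : Set Plane} (hopen : IsOpen Ω) (hconv : Convex ℝ Ω)
    (h0 : (0 : Plane) ∈ Ω) {lam : ℝ} (hlam : 0 ≤ lam) : BoundedOnLp Ω lam 2 := by
  refine ⟨1, fun f => ?_⟩
  set g : Plane → ℂ := fun ξ => (multiplier Ω lam ξ : ℂ) * 𝓕 (f : Plane → ℂ) ξ with hg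
  have hmeas : AEStronglyMeasurable g :=
    ((Complex.measurable_ofReal.comp
      (measurable_multiplier hopen hconv h0 lam)).aestronglyMeasurable).mul
      (𝓕 f).continuous.aestronglyMeasurable
  have hle : ∀ ξ, ‖g ξ‖ ≤ ‖(𝓕 f) ξ‖ := by
    intro ξ
    rw [hg]
    simp only [norm_mul, Complex.norm_real, Real.norm_of_nonneg (multiplier_nonneg Ω lam ξ)]
    exact mul_le_of_le_one_left (norm_nonneg _) (multiplier_le_one Ω hlam ξ)
  have hg1 : Integrable g := ((𝓕 f).integrable (μ := volume)).mono hmeas (.of_forall hle)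
  have hg2 : MemLp g 2 := ((𝓕 f).memLp 2).mono hmeas (.of_forall hle)
  calc eLpNorm (T Ω lam f) 2 volume = eLpNorm g 2 volume := eLpNorm_two_fourierInv hg1 hg2
    _ ≤ eLpNorm (𝓕 (f : Plane → ℂ)) 2 volume := eLpNorm_mono hle
    _ = _ := by rw [eLpNorm_two_fourier]; simp

lemma exists_schwartz_eq_one {Ω : Set Plane} (hbdd : Bornology.IsBounded Ω) :
    ∃ ψ : 𝓢(Plane, ℂ), ∀ ξ ∈ Ω, ψ ξ = 1 := by
  obtain ⟨M, hM0, hM⟩ := hbdd.subset_closedBall_lt 0 0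
  let b : ContDiffBump (0 : Plane) := ⟨M, M + 1, hM0, by linarith⟩
  have hb : ∀ ξ ∈ Ω, b ξ = 1 := fun ξ hξ => b.one_of_mem_closedBall (hM hξ)
  have hbc : HasCompactSupport fun x => (b x : ℂ) :=
    b.hasCompactSupport.comp_left (g := ((↑) : ℝ → ℂ)) (by simp)
  have hbs : ContDiff ℝ (⊤ : ℕ∞) fun x => (b x : ℂ) :=
    Complex.ofRealCLM.contDiff.comp b.contDiff
  refine ⟨hbc.toSchwartzMap hbs, fun ξ hξ => ?_⟩
  change (b ξ : ℂ) = 1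
  rw [hb ξ hξ, Complex.ofReal_one]

/-- The convolution kernel of `T_lam` is the value of `T_lam` at a Schwartz function whose Fourier
transform equals `1` on `Ω`. -/
lemma eLpNorm_fourierInv_multiplier_lt_top {Ω : Set Plane} (hopen : IsOpen Ω)
    (hconv : Convex ℝ Ω) (h0 : (0 : Plane) ∈ Ω) (hbdd : Bornology.IsBounded Ω) {lam : ℝ}
    {p : ℝ≥0∞} (h : BoundedOnLp Ω lam p) :
    eLpNorm (𝓕⁻ fun ξ => (multiplier Ω lam ξ : ℂ)) p volume < ∞ := by
  obtain ⟨C, hC⟩ := h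
  obtain ⟨ψ, hψ⟩ := exists_schwartz_eq_one hbdd
  obtain ⟨f, hf⟩ : ∃ f : 𝓢(Plane, ℂ), 𝓕 f = ψ :=
    ⟨𝓕⁻ ψ, FourierTransform.fourier_fourierInv_eq ψ⟩
  have hfour : 𝓕 (f : Plane → ℂ) = ψ := by rw [← SchwartzMap.fourier_coe, hf]
  have hT : T Ω lam f = 𝓕⁻ fun ξ => (multiplier Ω lam ξ : ℂ) := by
    unfold T
    rw [hfour]
    congr 1
    funext ξ
    by_cases hξ : ξ ∈ Ω
    · rw [hψ ξ hξ, mul_one]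
    · rw [multiplier_eq_zero hopen hconv h0 lam hξ, Complex.ofReal_zero, zero_mul]
  rw [← hT]
  exact (hC f).trans_lt (ENNReal.mul_lt_top ENNReal.coe_lt_top (f.memLp p volume).eLpNorm_lt_top)

/-! ### The bound on the number of caps -/

lemma exists_isBodyBetween_closure {Ω : Set Plane} (hopen : IsOpen Ω) (hconv : Convex ℝ Ω)
    (hbdd : Bornology.IsBounded Ω) (h0 : (0 : Plane) ∈ Ω) :
    ∃ r M, IsBodyBetween (closure Ω) r M := by
  obtain ⟨r, hr, hrΩ⟩ := Metric.nhds_basis_closedBall.mem_iff.1 (hopen.mem_nhds h0)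
  obtain ⟨M, hM⟩ := hbdd.closure.subset_closedBall 0
  exact ⟨r, M, hbdd.isCompact_closure, hconv.closure, hr, hrΩ.trans subset_closure, hM⟩

/-- The radial mass of the kernel in the direction `dir (t + τ)` controls the cap in the direction
`dir t`. -/
lemma le_lintegral_ray {Ω : Set Plane} (hopen : IsOpen Ω) (hconv : Convex ℝ Ω)
    (h0 : (0 : Plane) ∈ Ω) (hbdd : Bornology.IsBounded Ω) {r M δ lam t τ : ℝ}
    (hA : IsBodyBetween (closure Ω) r M) (hlam : 0 ≤ lam) (hδ : 0 < δ)
    (hδM : δ ≤ M) (hδ1 : δ ≤ 1 / 2) (hτ : |τ| ≤ arcRadius (closure Ω) r M δ t) :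
    ENNReal.ofReal (2 / (1 + (1 + 2 * Real.pi * (2 + M)) ^ 2) ^ 2 *
      (δ ^ lam * (volume.real (capRegion (closure Ω) t δ) / 4))) ≤
      ∫⁻ R in Set.Ioi (0 : ℝ), ‖𝓕⁻ (fun ξ => (multiplier Ω lam ξ : ℂ)) (R • dir (t + τ))‖ₑ *
        ENNReal.ofReal (δ ^ 2 * (R * Real.exp (-(δ * R)))) := by
  have hpi := Real.pi_pos
  have hint := integrable_multiplier hopen hconv h0 hbdd hlam
  refine le_trans (ENNReal.ofReal_le_ofReal ?_) (ofReal_integral_le_lintegral_ray hint (t + τ)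
    (supportFn (closure Ω) (t + τ)) hδ)
  set v : Plane → ℝ := fun ξ =>
    2 * Real.pi * (supportFn (closure Ω) (t + τ) - ⟪dir (t + τ), ξ⟫) / δ + 1 with hv
  set V := 1 + 2 * Real.pi * (2 + M) with hV
  set R := capRegion (closure Ω) (t + τ) ((2 + M) * δ) with hR
  have hv1 : ∀ ξ ∈ closure Ω, 1 ≤ v ξ := by
    intro ξ hξ
    have := inner_le_supportFn hA.isCompact (t + τ) hξ
    rw [hv]
    have h2 : 0 ≤ 2 * Real.pi * (supportFn (closure Ω) (t + τ) - ⟪dir (t + τ), ξ⟫) / δ :=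
      div_nonneg (mul_nonneg (by positivity) (by linarith)) hδ.le
    linarith
  have hvV : ∀ ξ ∈ R, v ξ ≤ V := by
    intro ξ hξ
    have h1 : supportFn (closure Ω) (t + τ) - ⟪dir (t + τ), ξ⟫ ≤ (2 + M) * δ := by
      linarith [hξ.2]
    have h2 : 2 * Real.pi * (supportFn (closure Ω) (t + τ) - ⟪dir (t + τ), ξ⟫) / δ
        ≤ 2 * Real.pi * (2 + M) := by
      rw [div_le_iff₀ hδ]
      nlinarith
    rw [hv, hV]
    linarith
  have hnonneg : ∀ ξ, 0 ≤ multiplier Ω lam ξ * (2 * v ξ / (1 + v ξ ^ 2) ^ 2) := by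
    intro ξ
    by_cases hξ : ξ ∈ Ω
    · have := hv1 ξ (subset_closure hξ)
      have := multiplier_nonneg Ω lam ξ
      positivity
    · rw [multiplier_eq_zero hopen hconv h0 lam hξ, zero_mul]
  have hle2 : ∀ x : ℝ, |2 * x / (1 + x ^ 2) ^ 2| ≤ 1 := by
    intro x
    rw [abs_le, le_div_iff₀ (by positivity), div_le_one (by positivity)]
    constructor <;> nlinarith [sq_nonneg (x - 1), sq_nonneg (x + 1), sq_nonneg (x ^ 2)]
  have hint' : Integrable fun ξ => multiplier Ω lam ξ * (2 * v ξ / (1 + v ξ ^ 2) ^ 2) := by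
    refine hint.mul_bdd (c := 1) ?_ (.of_forall fun ξ => hle2 _)
    have hvc : Continuous v := by rw [hv]; fun_prop
    exact ((by fun_prop : Continuous fun ξ => 2 * v ξ).div (by fun_prop)
      fun ξ => by positivity).aestronglyMeasurable
  have hRm : MeasurableSet R := (isCompact_capRegion hA.isCompact _ _).measurableSet
  calc 2 / (1 + V ^ 2) ^ 2 * (δ ^ lam * (volume.real (capRegion (closure Ω) t δ) / 4))
      ≤ 2 / (1 + V ^ 2) ^ 2 * ∫ ξ in R, multiplier Ω lam ξ := by
        gcongr
        exact le_setIntegral_multiplier hopen hconv h0 hbdd hA hlam hδ hδM hδ1 hτ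
    _ = ∫ ξ in R, multiplier Ω lam ξ * (2 / (1 + V ^ 2) ^ 2) := by
        rw [integral_mul_const, mul_comm]
    _ ≤ ∫ ξ in R, multiplier Ω lam ξ * (2 * v ξ / (1 + v ξ ^ 2) ^ 2) := by
        refine setIntegral_mono_on (hint.mul_const _).integrableOn hint'.integrableOn hRm
          fun ξ hξ => ?_
        have h1 := hv1 ξ hξ.1
        have h2 := hvV ξ hξ
        refine mul_le_mul_of_nonneg_left ?_ (multiplier_nonneg Ω lam ξ)
        gcongr
        linarith
    _ ≤ _ := setIntegral_le_integral hint' (.of_forall hnonneg)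

lemma lintegral_rays_le {K : Plane → ℂ} (hK : Continuous K) {p δ : ℝ} (hp : 1 ≤ p) (hδ : 0 < δ) :
    ∫⁻ s in Set.Ioo (-Real.pi) Real.pi, ∫⁻ R in Set.Ioi (0 : ℝ), ‖K (R • dir s)‖ₑ *
        ENNReal.ofReal (δ ^ 2 * (R * Real.exp (-(δ * R)))) ≤
      ENNReal.ofReal (δ ^ 2) * (eLpNorm K (ENNReal.ofReal p) volume *
        ENNReal.ofReal (2 * Real.pi / δ ^ 2) ^ (1 - 1 / p)) := by
  have hm : Measurable fun x : Plane => ‖K x‖ₑ * ENNReal.ofReal (Real.exp (-(δ * ‖x‖))) := by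
    have := hK.measurable
    fun_prop
  refine le_trans (le_of_eq ?_)
    (mul_le_mul_right (lintegral_enorm_mul_exp_le hK.aestronglyMeasurable hp hδ) _)
  rw [← lintegral_const_mul _ hm, ← lintegral_polar (hm.const_mul _)]
  congr 1
  funext s
  refine setLIntegral_congr_fun measurableSet_Ioi fun R hR => ?_
  have hR : 0 < R := hR
  simp only [norm_smul, norm_dir, mul_one, Real.norm_of_nonneg hR.le]
  rw [ENNReal.ofReal_mul (by positivity), ENNReal.ofReal_mul hR.le]
  ring

/-- Boundedness on `L^p` limits the number of caps: each direction in an arc of radius about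
`δ ^ 2 / |cap|` contributes about `δ ^ lam * |cap|`, so each cap contributes about `δ ^ (lam + 2)`
to an integral that Hölder's inequality bounds by `δ ^ (2 / p)`. -/
lemma exists_coverNum_le {Ω : Set Plane} (hopen : IsOpen Ω) (hconv : Convex ℝ Ω)
    (hbdd : Bornology.IsBounded Ω) (h0 : (0 : Plane) ∈ Ω) {lam p : ℝ} (hlam : 0 ≤ lam)
    (hp : 1 ≤ p) (h : BoundedOnLp Ω lam (ENNReal.ofReal p)) :
    ∃ C : ℝ, ∀ᶠ δ in 𝓝[>] (0 : ℝ), (coverNum Ω δ : ℝ) ≤ C * (δ⁻¹) ^ (lam + 2 - 2 / p) := by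
  obtain ⟨r, M, hA⟩ := exists_isBodyBetween_closure hopen hconv hbdd h0
  have hr := hA.pos
  have hM : 0 < M := hr.trans_le hA.le
  have hpi := Real.pi_pos
  have hint := integrable_multiplier hopen hconv h0 hbdd hlam
  set K : Plane → ℂ := 𝓕⁻ fun ξ => (multiplier Ω lam ξ : ℂ) with hK
  have hKc : Continuous K :=
    VectorFourier.fourierIntegral_continuous Real.continuous_fourierChar
      (by simp only [LinearMap.neg_apply]; exact (continuous_inner).neg) hint.ofReal
  have hKp : eLpNorm K (ENNReal.ofReal p) volume ≠ ∞ :=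
    (eLpNorm_fourierInv_multiplier_lt_top hopen hconv h0 hbdd h).ne
  set c := 2 / (1 + (1 + 2 * Real.pi * (2 + M)) ^ 2) ^ 2 with hc
  have hc0 : 0 < c := by positivity
  set η := r ^ 2 / (1000 * M ^ 2) with hη
  have hη0 : 0 < η := by positivity
  set k := (eLpNorm K (ENNReal.ofReal p) volume).toReal with hk
  refine ⟨4 * k * (2 * Real.pi) ^ (1 - 1 / p) / (c * η), ?_⟩
  filter_upwards [Ioc_mem_nhdsGT (show (0 : ℝ) < min M (1 / 2) by positivity)] with δ hδ'
  obtain ⟨hδ, hδ2⟩ := hδ'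
  obtain ⟨hδM, hδ1⟩ := le_min_iff.1 hδ2
  set a : ℝ := c * δ ^ lam * η * δ ^ 2 / 4 with ha
  have ha0 : 0 < a := by positivity
  obtain ⟨u, hu, hcard⟩ := exists_finset_arcs_cover
    (θ := arcRadius (closure Ω) r M δ) (a := ENNReal.ofReal a)
    (fun t => hA.arcRadius_pos t hδ hδM) (fun t => hA.five_mul_arcRadius_le t hδ hδM)
    (by simpa using ha0)
    (ENNReal.mul_ne_top ENNReal.ofReal_ne_top (ENNReal.mul_ne_top hKp
      (ENNReal.rpow_ne_top_of_nonneg (y := 1 - 1 / p) (by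
        have : 1 / p ≤ 1 := by rw [div_le_one (by linarith)]; exact hp
        linarith) (ENNReal.ofReal_ne_top (r := 2 * Real.pi / δ ^ 2)))))
    (fun t s hts => by
      have h1 := le_lintegral_ray hopen hconv h0 hbdd hA hlam hδ hδM hδ1 hts
      rw [add_sub_cancel] at h1
      refine le_trans ?_ (mul_le_mul_right h1 _)
      rw [← ENNReal.ofReal_mul (hA.arcRadius_pos t hδ hδM).le]
      apply ENNReal.ofReal_le_ofReal
      have := hA.arcRadius_mul_area t hδ hδM
      rw [← hη] at this
      apply le_of_eq
      rw [ha, ← hc]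
      linear_combination (-(c * δ ^ lam / 4)) * this)
    (lintegral_rays_le hKc hp hδ)
  have hN : (coverNum Ω δ : ℝ) ≤ u.card := by
    exact_mod_cast coverNum_le_card hopen hconv h0 hA hδ hδM u hu
  have hcard' : (u.card : ℝ) * a ≤ δ ^ 2 * (k * (2 * Real.pi / δ ^ 2) ^ (1 - 1 / p)) := by
    have hB : ENNReal.ofReal (δ ^ 2) * (eLpNorm K (ENNReal.ofReal p) volume *
        ENNReal.ofReal (2 * Real.pi / δ ^ 2) ^ (1 - 1 / p))
        = ENNReal.ofReal (δ ^ 2 * (k * (2 * Real.pi / δ ^ 2) ^ (1 - 1 / p))) := by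
      rw [ENNReal.ofReal_mul (by positivity), ENNReal.ofReal_mul ENNReal.toReal_nonneg,
        ENNReal.ofReal_toReal hKp, ENNReal.ofReal_rpow_of_pos (by positivity)]
    rw [hB, ← ENNReal.ofReal_natCast, ← ENNReal.ofReal_mul (by positivity),
      ENNReal.ofReal_le_ofReal_iff (by positivity)] at hcard
    exact hcard
  refine hN.trans ?_
  rw [← mul_le_mul_iff_left₀ ha0]
  refine hcard'.trans_eq ?_
  have e1 : (2 * Real.pi / δ ^ 2) ^ (1 - 1 / p)
      = (2 * Real.pi) ^ (1 - 1 / p) * δ⁻¹ ^ (2 - 2 / p) := by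
    rw [div_eq_mul_inv, Real.mul_rpow (by positivity) (by positivity), ← inv_pow,
      ← Real.rpow_natCast δ⁻¹ 2, ← Real.rpow_mul (by positivity)]
    congr 2
    push_cast
    ring
  have e2 : δ⁻¹ ^ (lam + 2 - 2 / p) * δ ^ lam = δ⁻¹ ^ (2 - 2 / p) := by
    rw [add_sub_assoc, Real.rpow_add (by positivity), Real.inv_rpow hδ.le lam]
    have : δ ^ lam ≠ 0 := by positivity
    field_simp
  rw [e1, ha, ← e2]
  field_simp

lemma kappa_le_of_coverNum_le {Ω : Set Plane} {a C : ℝ} (ha : 0 ≤ a)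
    (h : ∀ᶠ δ in 𝓝[>] (0 : ℝ), (coverNum Ω δ : ℝ) ≤ C * (δ⁻¹) ^ a) : kappa Ω ≤ a := by
  set C' := max C 1 with hC'
  have hC1 : 1 ≤ C' := le_max_right _ _
  have hL : Tendsto (fun δ : ℝ => Real.log δ⁻¹) (𝓝[>] 0) atTop :=
    Real.tendsto_log_atTop.comp tendsto_inv_nhdsGT_zero
  have hlim : Tendsto (fun δ : ℝ => Real.log C' / Real.log δ⁻¹ + a) (𝓝[>] 0) (𝓝 a) := by
    simpa using (hL.const_div_atTop (Real.log C')).add_const a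
  have hpos : ∀ᶠ δ : ℝ in 𝓝[>] 0, 0 < Real.log δ⁻¹ := hL.eventually_gt_atTop 0
  unfold kappa
  rw [← hlim.limsup_eq]
  refine limsup_le_limsup ?_ ?_ hlim.isBoundedUnder_le
  · filter_upwards [h, hpos, self_mem_nhdsWithin] with δ hδ hδL hδ0
    have hδ0 : 0 < δ := hδ0
    rw [div_add' _ _ _ hδL.ne']
    apply div_le_div_of_nonneg_right _ hδL.le
    -- If `coverNum Ω δ = 0`, its logarithm is `0` by convention.
    rcases Nat.eq_zero_or_pos (coverNum Ω δ) with h0 | h0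
    · rw [h0, Nat.cast_zero, Real.log_zero]
      have := Real.log_nonneg hC1
      positivity
    · have h1 : (0 : ℝ) < coverNum Ω δ := by exact_mod_cast h0
      have h2 : (0 : ℝ) < δ⁻¹ ^ a := by positivity
      rw [← Real.log_rpow (by positivity), ← Real.log_mul (by positivity) h2.ne']
      apply Real.log_le_log h1
      exact hδ.trans (mul_le_mul_of_nonneg_right (le_max_left _ _) h2.le)
  · refine isCoboundedUnder_le_of_eventually_le (x := 0) _ ?_
    filter_upwards [hpos] with δ hδL
    exact div_nonneg (Real.log_natCast_nonneg _) hδL.le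

lemma kappa_le_of_boundedOnLp {Ω : Set Plane} (hopen : IsOpen Ω) (hconv : Convex ℝ Ω)
    (hbdd : Bornology.IsBounded Ω) (h0 : (0 : Plane) ∈ Ω) {lam p : ℝ} (hlam : 0 ≤ lam)
    (hp : 1 ≤ p) (h : BoundedOnLp Ω lam (ENNReal.ofReal p)) :
    kappa Ω ≤ lam + 2 - 2 / p := by
  obtain ⟨C, hC⟩ := exists_coverNum_le hopen hconv hbdd h0 hlam hp h
  refine kappa_le_of_coverNum_le ?_ hC
  have : 2 / p ≤ 2 := div_le_self zero_le_two hp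
  linarith

end BochnerRiesz

end

theorem theorem1p3 (Ω : Set BochnerRiesz.Plane) (hopen : IsOpen Ω) (hconv : Convex ℝ Ω)
    (hbdd : Bornology.IsBounded Ω) (h0 : (0 : BochnerRiesz.Plane) ∈ Ω) :
    (∀ p : ℝ, 1 ≤ p → p ≤ 2 → ∀ lam : ℝ, 0 ≤ lam →
      lam < 1 / p - 1 + BochnerRiesz.kappa Ω / 2 →
      ¬ BochnerRiesz.BoundedOnLp Ω lam (ENNReal.ofReal p)) ∧
    2 / (2 - BochnerRiesz.kappa Ω) ≤ BochnerRiesz.pCrit Ω := by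
  refine ⟨fun p hp _ lam hlam hlt hB => ?_, ?_⟩
  · have h := BochnerRiesz.kappa_le_of_boundedOnLp hopen hconv hbdd h0 hlam hp hB
    have e : 2 / p = 2 * (1 / p) := by ring
    linarith
  · refine le_csInf ⟨2, one_le_two, fun lam hlam => ?_⟩ fun p ⟨hp, hB⟩ => ?_
    · simpa using BochnerRiesz.boundedOnLp_two hopen hconv h0 hlam.le
    · have hp0 : 0 < p := by linarith
      have h : BochnerRiesz.kappa Ω ≤ 2 - 2 / p := by
        refine le_of_forall_pos_le_add fun ε hε => ?_
        have := BochnerRiesz.kappa_le_of_boundedOnLp hopen hconv hbdd h0 hε.le hp (hB ε hε)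
        linarith
      have h2 : 2 / p ≤ 2 - BochnerRiesz.kappa Ω := by linarith
      have h3 : 0 < 2 / p := by positivity
      rw [div_le_iff₀ (h3.trans_le h2)]
      rw [div_le_iff₀ hp0] at h2
      linarith
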